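/- A network is a finite directed acyclic multigraph $G=(V,E)$ in which each edge carries one packet per phase; $s\in V$ is the source, and $\mathrm{maxflow}(t)$ is the maximum number of pairwise edge-disjoint directed paths from $s$ to $t$. A linear network code over a finite field $F$ for $n$ source packets and $p$ phases assigns to every edge $e$ and phase $j$ fixed coefficients by which the packet on $e$ in phase $j$ is a linear combination of the packets received, over the phases, on the edges entering the tail of $e$ and, if $e$ leaves $s$, of the source packets. All packets have the same length. A code over $GF(2)$, which uses only bitwise XOR of packets, is called an XOR-ed coding. The network with sinks $T\subseteq V$ of common max-flow $h$ is linearly solvable if for some finite field $F$ and some $\ell\ge 1$ there is a linear network code over $F$ for $\ell h$ source packets and $\ell$ phases from which every $t\in T$ can deduce all source packets. Theorem. Let $G$, $s$ and a set $T=\{t_1,\dots,t_N\}$ of $N$ sinks be given with $\mathrm{maxflow}(t_1)=\dots=\mathrm{maxflow}(t_N)=h$, and suppose that this network is linearly solvable. Then for all sufficiently large numbers $p$ of phases there is an XOR-ed coding for $n=p\times h$ source packets that achieves the multicast capacity $h$ in each of the $p$ phases: for every $t\in T$ there are $h$ distinct edges entering $t$ such that the $n$ packets $y$ that $t$ receives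 on them, $h$ in each of the $p$ phases, satisfy $y=K_t x$, where $x$ is the vector of the source packets and $K_t$ is a nonsingular $n\times n$ matrix over $GF(2)$. Moreover, the coding can be run causally with delays: there are delays $d(v)\in\mathbb N$ $(v \in V)$ such that, if the packets of phase $j$ on the edges entering $v$ are received in time slot $d(v)+j$ for every $v\in V$, then every packet is formed only from source packets and packets received in strictly earlier time slots. -/

import Mathlib

namespace NetworkCoding

/-- A directed multigraph with vertex set `V` and edge set `E`; the edge `e` leads from `tail e`
to `head e`, and carries one packet per phase. -/
structure Network (V E : Type*) where
  tail : E → V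
  head : E → V

namespace Network

variable {V E : Type*}

/-- There is no directed closed walk of positive length. -/
def Acyclic (G : Network V E) : Prop :=
  ∀ v, ¬ Relation.TransGen (fun u w => ∃ e, G.tail e = u ∧ G.head e = w) v v

/-- The list of edges `P` is a directed path from `s` to `t` (with at least one edge). -/
def IsPath (G : Network V E) (s t : V) (P : List E) : Prop :=
  (P.head?.map G.tail = some s) ∧ (P.getLast?.map G.head = some t) ∧
    P.IsChain (fun e f => G.head e = G.tail f)

/-- The numbers `k` for which there are `k` pairwise edge-disjoint paths from `s` to `t`, so that
`k` packets can be sent from `s` to `t` in one phase. -/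
def flowValues (G : Network V E) (s t : V) : Set ℕ :=
  {k | ∃ P : Fin k → List E, (∀ i, G.IsPath s t (P i)) ∧
    Pairwise fun i j => List.Disjoint (P i) (P j)}

/-- The max-flow from `s` to `t`: the largest number of pairwise edge-disjoint paths. -/
noncomputable def maxflow (G : Network V E) (s t : V) : ℕ :=
  sSup (G.flowValues s t)

/-- The supremum in the definition of `maxflow` is a maximum of a bounded set. -/
theorem flowValues_bddAbove [Fintype E] (G : Network V E) (s t : V) :
    BddAbove (G.flowValues s t) := by
  refine ⟨Fintype.card E, ?_⟩
  rintro k ⟨P, hP, hd⟩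
  have hne : ∀ i, P i ≠ [] := by
    intro i h0
    have := (hP i).1
    simp [h0] at this
  have hinj : Function.Injective fun i => (P i).head (hne i) := by
    intro i j hij
    by_contra hc
    have h2 : (P i).head (hne i) ∈ P j := by
      have h3 := List.head_mem (hne j)
      have h4 : (P i).head (hne i) = (P j).head (hne j) := hij
      rw [h4]
      exact h3
    exact hd hc (List.head_mem (hne i)) h2
  simpa using Fintype.card_le_of_injective _ hinj

end Network

/-- A linear network code over `F` on the network `G` with source `s`, for `n` source packets and
`p` phases. In phase `j` the edge `e` carries a linear combination, with fixed local coefficients,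
of the source packets (only if `e` leaves `s`) and of packets on the edges that enter the tail
of `e`. Written out in terms of the source packets, this combination has the coefficients
`globalCoeff e j`; on an acyclic network they are determined by the local coefficients.
For `F = ZMod 2` all that happens to packets is bitwise XOR. -/
structure LinearCode (F : Type*) [CommRing F] {V E : Type*} [Fintype E]
    (G : Network V E) (s : V) (n p : ℕ) where
  sourceCoeff : E → Fin p → Fin n → F
  relayCoeff : E → Fin p → E → Fin p → F
  globalCoeff : E → Fin p → Fin n → F
  sourceCoeff_eq_zero : ∀ e j m, G.tail e ≠ s → sourceCoeff e j m = 0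
  relayCoeff_eq_zero : ∀ e j e' j', G.head e' ≠ G.tail e → relayCoeff e j e' j' = 0
  globalCoeff_eq : ∀ e j m, globalCoeff e j m =
    sourceCoeff e j m + ∑ e', ∑ j', relayCoeff e j e' j' * globalCoeff e' j' m

/-- An XOR-ed coding: a linear network code over `GF(2)`. -/
abbrev XORCode {V E : Type*} [Fintype E] (G : Network V E) (s : V) (n p : ℕ) :=
  LinearCode (ZMod 2) G s n p

namespace LinearCode

variable {F : Type*} [CommRing F] {V E : Type*} [Fintype E] {G : Network V E} {s : V} {n p : ℕ}

/-- The packet on the edge `e` in phase `j` when the source packets are `x`. Packets are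
strings of a common length `L` over `F`. -/
def packet (C : LinearCode F G s n p) {L : ℕ} (x : Fin n → Fin L → F) (e : E) (j : Fin p) :
    Fin L → F :=
  ∑ m, C.globalCoeff e j m • x m

/-- The packets obey the local coding rule. -/
theorem packet_eq (C : LinearCode F G s n p) {L : ℕ} (x : Fin n → Fin L → F) (e : E)
    (j : Fin p) :
    C.packet x e j = ∑ m, C.sourceCoeff e j m • x m +
      ∑ e', ∑ j', C.relayCoeff e j e' j' • C.packet x e' j' := by
  unfold packet
  simp_rw [Finset.smul_sum, smul_smul]
  conv_lhs => enter [2, m]; rw [C.globalCoeff_eq e j m, add_smul, Finset.sum_smul]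
  rw [Finset.sum_add_distrib]
  congr 1
  rw [Finset.sum_comm]
  refine Finset.sum_congr rfl fun e' _ => ?_
  rw [Finset.sum_comm]
  refine Finset.sum_congr rfl fun m _ => ?_
  rw [Finset.sum_smul]

/-- The code can be run with the given delays: the packet of phase `j` reaches a vertex `v`, on
every edge that enters `v`, in the time slot `delay v + j`, and only packets received in strictly
earlier time slots are used to form a packet. -/
def IsCausal (C : LinearCode F G s n p) (delay : V → ℕ) : Prop :=
  ∀ e j e' j', C.relayCoeff e j e' j' ≠ 0 →
    delay (G.head e') + (j' : ℕ) < delay (G.head e) + (j : ℕ)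

/-- The sink `t` is able to deduce all source packets from what it receives. -/
def Decodes (C : LinearCode F G s n p) (t : V) : Prop :=
  Submodule.span F {v : Fin n → F | ∃ e j, G.head e = t ∧ v = C.globalCoeff e j} = ⊤

/-- The code for `p * h` source packets reaches rate `h` at the sink `t` in each of the `p` phases:
there are `h` distinct edges entering `t` such that the `p * h` packets `y` received on them, `h` in
each phase, are `y = K x` with a nonsingular matrix `K`. -/
def AchievesRate {h : ℕ} (C : LinearCode F G s (p * h) p) (t : V) : Prop :=
  ∃ (σ : Fin h → E) (K : Matrix (Fin (p * h)) (Fin (p * h)) F),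
    Function.Injective σ ∧ (∀ i, G.head (σ i) = t) ∧ IsUnit K.det ∧
    ∀ (L : ℕ) (x : Fin (p * h) → Fin L → F) (j : Fin p) (i : Fin h),
      C.packet x (σ i) j = ∑ m, K (finProdFinEquiv (j, i)) m • x m

end LinearCode

/-- The multicast of `h` packets per phase from `s` to all sinks in `T` has a linear solution over
some finite field, possibly a vector solution (over a positive number of phases). -/
def Network.LinearlySolvable {V E : Type*} [Fintype E] (G : Network V E) (s : V) (T : Finset V)
    (h : ℕ) : Prop :=
  ∃ (F : Type) (_ : Field F) (_ : Finite F) (ℓ : ℕ) (_ : 0 < ℓ) (C : LinearCode F G s (ℓ * h) ℓ),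
    ∀ t ∈ T, C.Decodes t

end NetworkCoding

namespace NetworkCoding

open MvPolynomial

/-! Take the local coefficients as indeterminates over GF(2). At each sink, routing along `h`
edge-disjoint paths specialises the transfer matrix to the identity, so its determinant is a nonzero
polynomial (`exists_edges_det_ne_zero`). The product of these determinants over the sinks has a
non-root with coordinates in GF(2^p) once 2^p exceeds its degree (`exists_aeval_ne_zero`). GF(2^p)
acts on itself by `p × p` matrices over GF(2), so one field symbol becomes `p` binary packets, one
per phase, and invertibility survives (`blockCode_achievesRate`). -/

theorem Network.Acyclic.exists_rank {V E : Type*} [Fintype V] {G : Network V E} (hG : G.Acyclic) :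
    ∃ r : V → ℕ, ∀ e, r (G.tail e) < r (G.head e) := by
  classical
  let R : V → V → Prop := Relation.TransGen fun u w => ∃ e, G.tail e = u ∧ G.head e = w
  refine ⟨fun v => (Finset.univ.filter fun u => R u v).card, fun e => ?_⟩
  have he : R (G.tail e) (G.head e) := .single ⟨e, rfl, rfl⟩
  refine Finset.card_lt_card ((Finset.ssubset_iff_of_subset fun u hu => ?_).2
    ⟨G.tail e, by simpa using he, by simpa using hG _⟩)
  simp only [Finset.mem_filter, Finset.mem_univ, true_and] at hu ⊢
  exact Relation.TransGen.trans hu he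

/-- An edge occurs at most once on a directed path of an acyclic network. -/
theorem Network.IsPath.nodup {V E : Type*} {G : Network V E} {r : V → ℕ}
    (hr : ∀ e, r (G.tail e) < r (G.head e)) {s t : V} {P : List E} (hP : G.IsPath s t P) :
    P.Nodup := by
  have h1 : (P.map fun e => r (G.tail e)).IsChain (· < ·) := by
    rw [List.isChain_map]
    refine hP.2.2.imp fun e f hef => ?_
    rw [← hef]
    exact hr e
  have h2 : (P.map fun e => r (G.tail e)).Nodup :=
    (List.isChain_iff_pairwise.1 h1).imp fun hab => hab.ne
  exact List.Nodup.of_map _ h2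

/-! ### Scalar coding vectors and their generic rank at a sink -/

namespace Network

variable {V E A B : Type*} [Fintype E] [CommRing A] [CommRing B] (G : Network V E) (s : V) {h : ℕ}

open Classical in
/-- The scalar source coefficients prescribed by `θ`, where the network permits them. -/
noncomputable def scalarSource (θ : E × (Fin h ⊕ E) → A) (e : E) (m : Fin h) : A :=
  if G.tail e = s then θ (e, .inl m) else 0

open Classical in
/-- The scalar relay coefficients prescribed by `θ`, where the network permits them. -/
noncomputable def scalarRelay (θ : E × (Fin h ⊕ E) → A) (e e' : E) : A :=
  if G.head e' = G.tail e then θ (e, .inr e') else 0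

/-- The scalar coding vectors after `k` rounds of applying the local coding rule. -/
noncomputable def scalarGlobal (θ : E × (Fin h ⊕ E) → A) : ℕ → E → Fin h → A
  | 0 => 0
  | k + 1 => fun e m =>
      G.scalarSource s θ e m + ∑ e', G.scalarRelay θ e e' * scalarGlobal θ k e' m

theorem scalarGlobal_succ_apply (θ : E × (Fin h ⊕ E) → A) (k : ℕ) (e : E) (m : Fin h) :
    G.scalarGlobal s θ (k + 1) e m =
      G.scalarSource s θ e m + ∑ e', G.scalarRelay θ e e' * G.scalarGlobal s θ k e' m := rfl

/-- Lets the generic vectors be specialised, both to a routing and to values in an extension field.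
-/
theorem map_scalarGlobal (φ : A →+* B) (θ : E × (Fin h ⊕ E) → A) (k : ℕ) (e : E) (m : Fin h) :
    φ (G.scalarGlobal s θ k e m) = G.scalarGlobal s (φ ∘ θ) k e m := by
  induction k generalizing e with
  | zero => simp [scalarGlobal]
  | succ k ih =>
    simp only [scalarGlobal, map_add, map_sum, map_mul, ih]
    simp [scalarSource, scalarRelay, apply_ite φ]

variable {G}

/-- Edges feeding `e` have tails of smaller rank, so the iteration stabilises along the rank. After
more rounds than any rank it satisfies the local coding rule exactly. -/
theorem scalarGlobal_succ {r : V → ℕ} (hr : ∀ e, r (G.tail e) < r (G.head e))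
    (θ : E × (Fin h ⊕ E) → A) {k : ℕ} {e : E} (hk : r (G.tail e) < k) :
    G.scalarGlobal s θ (k + 1) e = G.scalarGlobal s θ k e := by
  induction k generalizing e with
  | zero => omega
  | succ k ih =>
    funext m
    rw [scalarGlobal_succ_apply, scalarGlobal_succ_apply]
    congr 1
    refine Finset.sum_congr rfl fun e' _ => ?_
    by_cases hee : G.head e' = G.tail e
    · rw [ih]
      have := hr e'
      rw [hee] at this
      omega
    · simp [scalarRelay, hee]

variable {s}

open Classical in
/-- The local coefficients by which the `i`-th packet is routed along the `i`-th list of edges. -/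
noncomputable def routing (A : Type*) [CommRing A] (P : Fin h → List E) :
    E × (Fin h ⊕ E) → A := fun x =>
  match x.2 with
  | .inl m => if (P m)[0]? = some x.1 then 1 else 0
  | .inr e' => if ∃ (i : Fin h) (k : ℕ), (P i)[k]? = some e' ∧ (P i)[k + 1]? = some x.1 then 1 else 0

/-- Routing along disjoint paths delivers the `i`-th packet along the `i`-th path. -/
theorem scalarGlobal_routing {r : V → ℕ} (hr : ∀ e, r (G.tail e) < r (G.head e)) {t : V}
    {P : Fin h → List E} (hP : ∀ i, G.IsPath s t (P i))
    (hd : Pairwise fun i j => List.Disjoint (P i) (P j)) {N : ℕ} (hN : ∀ v, r v < N)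
    (i : Fin h) (k : ℕ) (e : E) (he : (P i)[k]? = some e) :
    G.scalarGlobal s (routing A P) N e = Pi.single i 1 := by
  -- An edge determines its path and its position there, so at most one term of the recursion
  -- survives.
  have huniq : ∀ {i j : Fin h} {k l : ℕ} {e : E}, (P i)[k]? = some e → (P j)[l]? = some e →
      i = j ∧ k = l := by
    intro i j k l e h1 h2
    have hij : i = j := by
      by_contra hc
      exact hd hc (List.mem_of_getElem? h1) (List.mem_of_getElem? h2)
    subst hij
    refine ⟨rfl, ?_⟩
    obtain ⟨hk, h1⟩ := List.getElem?_eq_some_iff.1 h1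
    obtain ⟨hl, h2⟩ := List.getElem?_eq_some_iff.1 h2
    exact ((hP i).nodup hr).getElem_inj_iff.1 (h1.trans h2.symm)
  induction k generalizing e with
  | zero =>
    rw [← scalarGlobal_succ s hr _ (hN _)]
    funext m
    have hs : G.tail e = s := by
      have := (hP i).1
      rw [List.head?_eq_getElem?, he] at this
      simpa using this
    have hrel : ∀ e', G.scalarRelay (routing A P) e e' = 0 := by
      intro e'
      have : ¬ ∃ (j : Fin h) (k : ℕ), (P j)[k]? = some e' ∧ (P j)[k + 1]? = some e := by
        rintro ⟨j, k, -, h2⟩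
        have := (huniq he h2).2
        omega
      simp [scalarRelay, routing, this]
    rw [scalarGlobal_succ_apply]
    simp only [hrel, zero_mul, Finset.sum_const_zero, add_zero, scalarSource, hs, if_true, routing]
    by_cases hm : m = i
    · subst hm
      simp [he]
    · rw [if_neg fun h2 => hm (huniq h2 he).1, Pi.single_eq_of_ne hm]
  | succ k ih =>
    rw [← scalarGlobal_succ s hr _ (hN _)]
    funext m
    obtain ⟨hk, hek⟩ := List.getElem?_eq_some_iff.1 he
    have he' : (P i)[k]? = some (P i)[k] := List.getElem?_eq_getElem _
    have hadj : G.head (P i)[k] = G.tail e := by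
      rw [← hek]
      exact List.isChain_iff_getElem.1 (hP i).2.2 k hk
    have hsrc : G.scalarSource s (routing A P) e m = 0 := by
      have : ¬ (P m)[0]? = some e := by
        intro h2
        have := (huniq he h2).2
        omega
      simp [scalarSource, routing, this]
    rw [scalarGlobal_succ_apply, hsrc, zero_add, Finset.sum_eq_single (P i)[k], ih _ he']
    · have : ∃ (j : Fin h) (l : ℕ), (P j)[l]? = some (P i)[k] ∧ (P j)[l + 1]? = some e :=
        ⟨i, k, he', he⟩
      simp only [scalarRelay, hadj, if_true, routing, if_pos this, one_mul]
    · intro e' _ hne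
      have : ¬ ∃ (j : Fin h) (l : ℕ), (P j)[l]? = some e' ∧ (P j)[l + 1]? = some e := by
        rintro ⟨j, l, h1, h2⟩
        obtain ⟨rfl, hl⟩ := huniq he h2
        obtain rfl : k = l := by omega
        rw [h1] at he'
        exact hne (Option.some.inj he')
      simp [scalarRelay, routing, this]
    · simp

/-- At a sink of max-flow `h` there are `h` incoming edges at which the matrix of the generic
coding vectors is nonsingular. -/
theorem exists_edges_det_ne_zero {r : V → ℕ} (hr : ∀ e, r (G.tail e) < r (G.head e)) {t : V}
    (ht : G.maxflow s t = h) {N : ℕ} (hN : ∀ v, r v < N) (A : Type*) [CommRing A] [Nontrivial A] :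
    ∃ σ : Fin h → E, Function.Injective σ ∧ (∀ i, G.head (σ i) = t) ∧
      (Matrix.of fun i => G.scalarGlobal s
        (X : E × (Fin h ⊕ E) → MvPolynomial (E × (Fin h ⊕ E)) A) N (σ i)).det ≠ 0 := by
  have hne : (G.flowValues s t).Nonempty := ⟨0, fun i => i.elim0, fun i => i.elim0, fun i => i.elim0⟩
  have hmem := Nat.sSup_mem hne (G.flowValues_bddAbove s t)
  rw [← maxflow, ht] at hmem
  obtain ⟨P, hP, hd⟩ := hmem
  have hlast : ∀ i, ∃ e, (P i).getLast? = some e ∧ G.head e = t := by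
    intro i
    simpa using (hP i).2.1
  choose σ hσ hσt using hlast
  refine ⟨σ, fun i j hij => ?_, hσt, fun h0 => ?_⟩
  · by_contra hc
    refine hd hc (List.mem_of_getLast? (hσ i)) ?_
    rw [hij]
    exact List.mem_of_getLast? (hσ j)
  · have h1 := congrArg (eval (routing A P)) h0
    rw [RingHom.map_det, map_zero] at h1
    have h2 : (eval (routing A P)).mapMatrix (Matrix.of fun i => G.scalarGlobal s
        (X : E × (Fin h ⊕ E) → MvPolynomial (E × (Fin h ⊕ E)) A) N (σ i)) = 1 := by
      ext i m
      have hX : (eval (routing A P)) ∘ (X : E × (Fin h ⊕ E) → MvPolynomial (E × (Fin h ⊕ E)) A)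
          = routing A P := by
        funext x
        simp
      have hi := hσ i
      rw [List.getLast?_eq_getElem?] at hi
      rw [RingHom.mapMatrix_apply, Matrix.map_apply, Matrix.of_apply, map_scalarGlobal, hX,
        scalarGlobal_routing hr hP hd hN i _ _ hi, Matrix.one_apply, Pi.single_apply]
      simp only [eq_comm]
    rw [h2, Matrix.det_one] at h1
    exact one_ne_zero h1

end Network

/-- A nonzero polynomial over `F` does not vanish identically on a sufficiently large field. -/
theorem exists_aeval_ne_zero {ι F K : Type*} [Finite ι] [Field F] [Field K] [Algebra F K] [Finite K]
    {f : MvPolynomial ι F} (hf : f ≠ 0) (hK : f.totalDegree < Nat.card K) :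
    ∃ x : ι → K, aeval x f ≠ 0 := by
  classical
  have := Fintype.ofFinite K
  by_contra! hc
  have hinj := FaithfulSMul.algebraMap_injective F K
  -- Each variable ranges over all of `K`, which has more elements than the degree in that variable.
  refine hf ((map_eq_zero_iff _ (map_injective (algebraMap F K) hinj)).1
    (eq_zero_of_eval_zero_at_prod_finset _ (fun _ => Finset.univ) (fun i => ?_) fun x _ => ?_))
  · rw [Finset.card_univ, ← Nat.card_eq_fintype_card]
    exact ((degreeOf_le_totalDegree _ i).trans (Finset.sup_mono (support_map_subset _ _))).trans_lt hK
  · rw [eval_map, ← aeval_def, hc]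

/-! ### From scalars in an extension to codes over several phases -/

/-- The linear code over `F` obtained from scalar coefficients in a ring `K` by representing `K` by
`p × p` matrices over `F`; the `p` coordinates of an element of `K` are sent in `p` phases. -/
noncomputable def blockCode {V E F K : Type*} [Fintype E] [CommRing F] [CommRing K]
    {G : Network V E} (s : V) {r : V → ℕ} (hr : ∀ e, r (G.tail e) < r (G.head e)) {N : ℕ}
    (hN : ∀ v, r v < N) {h p : ℕ} (φ : K →+* Matrix (Fin p) (Fin p) F)
    (θ : E × (Fin h ⊕ E) → K) : LinearCode F G s (p * h) p where
  sourceCoeff e j m :=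
    φ (G.scalarSource s θ e (finProdFinEquiv.symm m).2) j (finProdFinEquiv.symm m).1
  relayCoeff e j e' j' := φ (G.scalarRelay θ e e') j j'
  globalCoeff e j m :=
    φ (G.scalarGlobal s θ N e (finProdFinEquiv.symm m).2) j (finProdFinEquiv.symm m).1
  sourceCoeff_eq_zero e j m he := by simp [Network.scalarSource, he]
  relayCoeff_eq_zero e j e' j' he := by simp [Network.scalarRelay, he]
  globalCoeff_eq e j m := by
    rw [← Network.scalarGlobal_succ s hr θ (hN (G.tail e)), Network.scalarGlobal_succ_apply]
    simp only [map_add, map_sum, map_mul, Matrix.add_apply, Matrix.sum_apply, Matrix.mul_apply]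

/-- Rank grows by at least one along each edge, so the delay grows by at least `p`: all `p` phases
of the incoming packets arrive before phase 0 of the outgoing ones. -/
theorem blockCode_isCausal {V E F K : Type*} [Fintype E] [CommRing F] [CommRing K]
    {G : Network V E} (s : V) {r : V → ℕ} (hr : ∀ e, r (G.tail e) < r (G.head e)) {N : ℕ}
    (hN : ∀ v, r v < N) {h p : ℕ} (φ : K →+* Matrix (Fin p) (Fin p) F)
    (θ : E × (Fin h ⊕ E) → K) :
    (blockCode s hr hN φ θ).IsCausal fun v => p * r v := by
  intro e j e' j' hne
  have hadj : G.head e' = G.tail e := by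
    by_contra hc
    exact hne ((blockCode s hr hN φ θ).relayCoeff_eq_zero e j e' j' hc)
  have h1 : p * (r (G.head e') + 1) ≤ p * r (G.head e) :=
    Nat.mul_le_mul_left p (hadj ▸ hr e)
  have h2 := j'.isLt
  rw [mul_add, mul_one] at h1
  show p * r (G.head e') + (j' : ℕ) < p * r (G.head e) + (j : ℕ)
  omega

theorem blockCode_achievesRate {V E F K : Type*} [Fintype E] [CommRing F] [CommRing K]
    {G : Network V E} (s : V) {r : V → ℕ} (hr : ∀ e, r (G.tail e) < r (G.head e)) {N : ℕ}
    (hN : ∀ v, r v < N) {h p : ℕ} (φ : K →+* Matrix (Fin p) (Fin p) F)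
    (θ : E × (Fin h ⊕ E) → K) {t : V} {σ : Fin h → E} (hσ : Function.Injective σ)
    (hσt : ∀ i, G.head (σ i) = t)
    (hdet : IsUnit (Matrix.of fun i => G.scalarGlobal s θ N (σ i)).det) :
    (blockCode s hr hN φ θ).AchievesRate t := by
  let M : Matrix (Fin h) (Fin h) K := Matrix.of fun i => G.scalarGlobal s θ N (σ i)
  -- The block matrix is indexed by edge, then phase; the packets are numbered by phase, then edge.
  let ε : Fin h × Fin p ≃ Fin (p * h) := (Equiv.prodComm _ _).trans finProdFinEquiv
  have hM : IsUnit (Matrix.compRingEquiv (Fin h) (Fin p) F (φ.mapMatrix M)) :=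
    (((Matrix.isUnit_iff_isUnit_det M).2 hdet).map φ.mapMatrix).map
      (Matrix.compRingEquiv (Fin h) (Fin p) F)
  refine ⟨σ, Matrix.reindex ε ε (Matrix.compRingEquiv (Fin h) (Fin p) F (φ.mapMatrix M)), hσ, hσt,
    ?_, fun L x j i => ?_⟩
  · rw [Matrix.det_reindex_self]
    exact (Matrix.isUnit_iff_isUnit_det _).1 hM
  · rw [LinearCode.packet]
    refine Finset.sum_congr rfl fun m _ => ?_
    congr 1
    simp only [ε, M, blockCode, Matrix.reindex_apply, Matrix.submatrix_apply, Equiv.symm_trans_apply,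
      Equiv.symm_apply_apply]
    rfl

end NetworkCoding

open NetworkCoding MvPolynomial in
theorem theorem3 {V E : Type*} [Fintype V] [Fintype E]
    (G : NetworkCoding.Network V E) (hG : G.Acyclic) (s : V)
    (T : Finset V) (h : ℕ) (hflow : ∀ t ∈ T, G.maxflow s t = h)
    (hsolv : G.LinearlySolvable s T h) :
    ∃ p₀ : ℕ, ∀ p : ℕ, p₀ ≤ p →
      ∃ C : NetworkCoding.XORCode G s (p * h) p,
        (∃ delay : V → ℕ, C.IsCausal delay) ∧ ∀ t ∈ T, C.AchievesRate t := by
  obtain ⟨r, hr⟩ := hG.exists_rank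
  obtain ⟨N, hN⟩ : ∃ N, ∀ v, r v < N :=
    ⟨Finset.univ.sup r + 1, fun v => Nat.lt_succ_of_le (Finset.le_sup (Finset.mem_univ v))⟩
  have hσ (t : T) := Network.exists_edges_det_ne_zero hr (hflow t t.2) hN (ZMod 2)
  choose σ hinj hhead hdet using hσ
  let f : MvPolynomial (E × (Fin h ⊕ E)) (ZMod 2) :=
    ∏ t : T, (Matrix.of fun i => G.scalarGlobal s X N (σ t i)).det
  have hf : f ≠ 0 := Finset.prod_ne_zero_iff.2 fun t _ => hdet t
  -- The bound `deg f < p` gives both `p ≠ 0` and `deg f < 2 ^ p`.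
  refine ⟨f.totalDegree + 1, fun p hp => ?_⟩
  have hp0 : p ≠ 0 := by omega
  have hcard : f.totalDegree < Nat.card (GaloisField 2 p) := by
    rw [GaloisField.card 2 p hp0]
    exact hp.trans Nat.lt_two_pow_self.le
  obtain ⟨θ, hθ⟩ := exists_aeval_ne_zero hf hcard
  let b : Module.Basis (Fin p) (ZMod 2) (GaloisField 2 p) :=
    Module.finBasisOfFinrankEq _ _ (GaloisField.finrank 2 hp0)
  refine ⟨blockCode s hr hN (Algebra.leftMulMatrix b).toRingHom θ,
    ⟨_, blockCode_isCausal s hr hN _ θ⟩, fun t ht => ?_⟩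
  refine blockCode_achievesRate s hr hN _ θ (hinj ⟨t, ht⟩) (hhead ⟨t, ht⟩) ?_
  rw [map_prod] at hθ
  have h1 := Finset.prod_ne_zero_iff.1 hθ ⟨t, ht⟩ (Finset.mem_univ _)
  have hX : (aeval θ : MvPolynomial _ (ZMod 2) →ₐ[ZMod 2] GaloisField 2 p).toRingHom ∘ X = θ := by
    funext x
    simp
  rw [isUnit_iff_ne_zero]
  convert h1
  rw [AlgHom.map_det]
  congr 1
  ext i m
  rw [AlgHom.mapMatrix_apply, Matrix.map_apply, Matrix.of_apply, Matrix.of_apply]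
  exact (congrArg (G.scalarGlobal s · N (σ ⟨t, ht⟩ i) m) hX).symm.trans
    (Network.map_scalarGlobal G s
      (aeval θ : MvPolynomial _ (ZMod 2) →ₐ[ZMod 2] GaloisField 2 p).toRingHom X N _ m).symm
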